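/- Let $G$ be a finite $2$-connected simple plane graph (vertices are distinct points of the plane, edges are Jordan arcs that join their ends and meet vertices and one another only in common ends). Its faces are the connected components of the complement of the drawing; let $F_0$ be the outer (unbounded) face. Assume that $G$ is outerplane, i.e. that every vertex lies on the boundary of $F_0$, and that $G$ has at least one bounded face. Then the vertices and edges of $G$ that lie on the boundary of $F_0$ form a Hamiltonian circle $\partial F_0$ of $G$ (a cycle, regarded as a subgraph, through all vertices), and it is the only Hamiltonian circle of $G$. -/

import Mathlib

/-- The Euclidean plane, realised as `ℂ`. -/
abbrev Plane : Type := ℂ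

/-- `A` is a (Jordan) arc joining `x` and `y`: the image of an injective continuous map from the
unit interval to the plane that sends `0` to `x` and `1` to `y`. -/
def IsArcBetween (A : Set Plane) (x y : Plane) : Prop :=
  ∃ γ : Path x y, Function.Injective γ ∧ Set.range γ = A

/-- A simple plane graph on the vertex set `V`: a simple graph together with a drawing in the plane
in which distinct vertices are distinct points, every edge is an arc joining its two ends, an edge
passes through no vertex other than its ends, and distinct edges meet only in vertices. -/
structure PlaneGraph (V : Type*) where
  /-- The underlying abstract simple graph. -/
  graph : SimpleGraph V
  /-- The point that represents a vertex. -/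
  point : V → Plane
  /-- The (closed) arc that represents an edge. -/
  arc : graph.edgeSet → Set Plane
  point_injective : Function.Injective point
  isArcBetween : ∀ (u v : V) (h : graph.Adj u v),
    IsArcBetween (arc ⟨s(u, v), h⟩) (point u) (point v)
  mem_of_point_mem_arc : ∀ (e : graph.edgeSet) (w : V), point w ∈ arc e → w ∈ (e : Sym2 V)
  arc_inter_subset : ∀ e f : graph.edgeSet, e ≠ f → arc e ∩ arc f ⊆ Set.range point

namespace PlaneGraph

variable {V : Type*} (Γ : PlaneGraph V)

/-- The set of all points of the plane that lie on the drawing. -/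
def pointSet : Set Plane := Set.range Γ.point ∪ ⋃ e, Γ.arc e

/-- The faces are the connected components of the complement of the drawing. -/
def IsFace (F : Set Plane) : Prop :=
  ∃ x ∈ Γ.pointSetᶜ, F = connectedComponentIn Γ.pointSetᶜ x

/-- A bounded face. -/
def IsBoundedFace (F : Set Plane) : Prop := Γ.IsFace F ∧ Bornology.IsBounded F

/-- The outer face: the unbounded face. -/
def IsOuterFace (F : Set Plane) : Prop := Γ.IsFace F ∧ ¬ Bornology.IsBounded F

/-- A plane graph is outerplane if every vertex lies on the boundary of the outer face. -/
def IsOuterplane : Prop :=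
  ∃ F₀, Γ.IsOuterFace F₀ ∧ ∀ v, Γ.point v ∈ frontier F₀

/-- The boundary of a face `F`, as a subgraph: the vertices and edges that lie on the
topological boundary of `F`. -/
def boundary (F : Set Plane) : Γ.graph.Subgraph where
  verts := {v | Γ.point v ∈ frontier F}
  Adj u v := ∃ h : Γ.graph.Adj u v, Γ.arc ⟨s(u, v), h⟩ ⊆ frontier F
  adj_sub h := h.1
  edge_vert := by
    rintro u v ⟨h, hF⟩
    obtain ⟨γ, -, hγ⟩ := Γ.isArcBetween u v h
    exact hF (hγ ▸ ⟨0, γ.source⟩)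
  symm := by
    refine ⟨?_⟩
    rintro u v ⟨h, hF⟩
    have key : (⟨s(v, u), h.symm⟩ : Γ.graph.edgeSet) = ⟨s(u, v), h⟩ := Subtype.ext Sym2.eq_swap
    exact ⟨h.symm, by rw [key]; exact hF⟩

end PlaneGraph

namespace SimpleGraph

variable {V : Type*} (G : SimpleGraph V)

/-- A graph is 2-connected if it has at least three vertices, is connected, and stays connected
after the deletion of any one vertex. -/
def IsTwoConnected : Prop :=
  3 ≤ Nat.card V ∧ G.Connected ∧ ∀ v : V, (G.induce {v}ᶜ).Connected

variable {G} in
/-- A Hamiltonian circle of `G`: a subgraph of `G` that is traced out by a Hamiltonian cycle.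
Circles are subgraphs, so a base point and a direction do not count. -/
def IsHamiltonianCircle [DecidableEq V] (C : G.Subgraph) : Prop :=
  ∃ (v : V) (p : G.Walk v v), p.IsHamiltonianCycle ∧ p.toSubgraph = C

end SimpleGraph

/-! The core is a fact about theta curves: of three arcs with common ends and otherwise disjoint,
one runs inside the closed curve formed by the other two (`IsArcBetween.theta`). In an outerplane
graph a vertex off a cycle lies outside it, because the outer face does
(`IsOuterplane.point_mem_outerRegion`). Hence three internally disjoint paths with common ends
cannot all have inner vertices.

A longest cycle is therefore Hamiltonian: if it missed a vertex, 2-connectedness would give it an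
ear with an inner vertex, and maximality would give inner vertices to both halves of the cycle. For
any Hamiltonian cycle `c`, every other edge is a chord, which runs inside `c` by the theta lemma. So
the boundary of the outer face is exactly `c` (`IsOuterplane.toSubgraph_eq_boundary`), and as that
boundary is defined without `c`, uniqueness follows too.

The topology rests on winding numbers, written as differences of increments of a logarithm of `w -
z` along two arcs. They are constant on connected sets off the curve, vanish far out, and are
nonzero somewhere. Moreover an arc does not separate the plane. The count of exactly two components
in the Jordan curve theorem is not needed. -/

section

open Set Topology unitInterval Filter

/-! ### Continuous logarithms -/

theorem Continuous.exists_exp_eq {A : Type*} [TopologicalSpace A] [SimplyConnectedSpace A]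
    [LocallyPathConnectedSpace A] {f : A → ℂ} (hf : Continuous f) (h0 : ∀ a, f a ≠ 0) :
    ∃ g : A → ℂ, Continuous g ∧ ∀ a, Complex.exp (g a) = f a := by
  obtain ⟨a₀⟩ : Nonempty A := inferInstance
  obtain ⟨F, ⟨-, hF⟩, -⟩ := Complex.isCoveringMapOn_exp.existsUnique_continuousMap_lifts
    ⟨f, hf⟩ (a₀ := a₀) (e₀ := Complex.log (f a₀)) (Complex.exp_log (h0 a₀)) (fun a => h0 a)
  exact ⟨F, F.continuous, fun a => congrFun hF a⟩

theorem Continuous.exists_exp_eq_unitInterval {f : I → ℂ} (hf : Continuous f)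
    (h0 : ∀ t, f t ≠ 0) : ∃ g : I → ℂ, Continuous g ∧ ∀ t, Complex.exp (g t) = f t := by
  -- The function is extended to `ℝ`, constantly beyond the ends, and lifted there.
  obtain ⟨g, hg, hgf⟩ := (hf.comp (continuous_projIcc (h := zero_le_one' ℝ))).exists_exp_eq
    (fun a => h0 _)
  refine ⟨fun t => g t, hg.comp continuous_subtype_val, fun t => ?_⟩
  rw [hgf, Function.comp_apply, projIcc_val]

/-- The fibre of `exp` over `1` is discrete. All constancy of winding numbers comes from here. -/
theorem IsPreconnected.eq_of_exp_eq_one {A : Type*} [TopologicalSpace A] {S : Set A}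
    (hS : IsPreconnected S) {h : A → ℂ} (hh : ContinuousOn h S)
    (h1 : ∀ x ∈ S, Complex.exp (h x) = 1) {x y : A} (hx : x ∈ S) (hy : y ∈ S) : h x = h y :=
  Complex.isCoveringMap_exp.constOn_of_comp hS hh
    (fun a ha b hb => Subtype.ext ((h1 a ha).trans (h1 b hb).symm)) hx hy

theorem IsPreconnected.sub_eq_sub_of_exp_eq {A : Type*} [TopologicalSpace A] {S : Set A}
    (hS : IsPreconnected S) {f g : A → ℂ} (hf : ContinuousOn f S) (hg : ContinuousOn g S)
    (h : ∀ x ∈ S, Complex.exp (f x) = Complex.exp (g x)) {x y : A} (hx : x ∈ S) (hy : y ∈ S) :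
    f x - g x = f y - g y :=
  hS.eq_of_exp_eq_one (h := fun x => f x - g x) (hf.sub hg)
    (fun x hx => by rw [Complex.exp_sub, h x hx, div_self (Complex.exp_ne_zero _)]) hx hy

/-- The function `z - a` has no continuous logarithm on a circle around `a`. -/
theorem not_exists_exp_eq_sub_on_sphere (a : ℂ) {r : ℝ} (hr : 0 < r) (g : ℂ → ℂ)
    (hg : ContinuousOn g (Metric.sphere a r)) :
    ¬ ∀ z ∈ Metric.sphere a r, Complex.exp (g z) = z - a := by
  intro h
  have hmem : ∀ θ : ℝ, circleMap a r θ ∈ Metric.sphere a r :=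
    fun θ => circleMap_mem_sphere a hr.le θ
  -- Along the circle `g` can differ from `log r + iθ` only by a constant, yet `g` returns to its
  -- value after a full turn.
  have key := isPreconnected_univ.sub_eq_sub_of_exp_eq (A := ℝ)
    (f := fun θ => g (circleMap a r θ)) (g := fun θ => Complex.log r + θ * Complex.I)
    ((hg.comp_continuous (continuous_circleMap a r) hmem).continuousOn)
    (by fun_prop) (fun θ _ => ?_) (mem_univ 0) (mem_univ (2 * Real.pi))
  · have h0 : circleMap a r (2 * Real.pi) = circleMap a r 0 := by simp [circleMap]
    simp only [h0] at key
    have : (2 * Real.pi : ℂ) * Complex.I = 0 := by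
      push_cast at key
      linear_combination key
    simp [Real.pi_ne_zero] at this
  · rw [h _ (hmem θ), Complex.exp_add, Complex.exp_log (by exact_mod_cast hr.ne')]
    simp [circleMap]

/-! ### The increment of the logarithm along a path -/

open Classical in
/-- The increment of a continuous logarithm of `w - z` as `w` runs along the path `γ`. -/
noncomputable def Path.logIncrement {p q : ℂ} (γ : Path p q) (z : ℂ) : ℂ :=
  if h : ∃ l : I → ℂ, Continuous l ∧ ∀ t, Complex.exp (l t) = γ t - z then
    -- The default `0` occurs exactly for `z` on the path, where `w - z` has a zero.
    h.choose 1 - h.choose 0 else 0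

namespace Path

variable {p q : ℂ} (γ : Path p q) {z : ℂ}

theorem exists_log (hz : z ∉ range γ) :
    ∃ l : I → ℂ, Continuous l ∧ ∀ t, Complex.exp (l t) = γ t - z :=
  Continuous.exists_exp_eq_unitInterval (by fun_prop)
    (fun t => sub_ne_zero.2 fun h => hz ⟨t, h⟩)

theorem logIncrement_eq {l : I → ℂ} (hl : Continuous l)
    (h : ∀ t, Complex.exp (l t) = γ t - z) : γ.logIncrement z = l 1 - l 0 := by
  have hex : ∃ l : I → ℂ, Continuous l ∧ ∀ t, Complex.exp (l t) = γ t - z := ⟨l, hl, h⟩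
  rw [logIncrement, dif_pos hex]
  have := isPreconnected_univ.sub_eq_sub_of_exp_eq hex.choose_spec.1.continuousOn
    hl.continuousOn (fun t _ => (hex.choose_spec.2 t).trans (h t).symm) (mem_univ 0) (mem_univ 1)
  linear_combination -this

/-- The right side depends only on the ends, so increments along two paths with common ends differ
by a multiple of `2πi`: the winding of the closed curve they form. -/
theorem exp_logIncrement (hz : z ∉ range γ) :
    Complex.exp (γ.logIncrement z) = (q - z) / (p - z) := by
  obtain ⟨l, hl, h⟩ := γ.exists_log hz
  rw [γ.logIncrement_eq hl h, Complex.exp_sub, h, h, γ.source, γ.target]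

theorem isClosed_range : IsClosed (range γ) := (isCompact_range γ.continuous).isClosed

theorem continuousAt_logIncrement (hz : z ∉ range γ) : ContinuousAt γ.logIncrement z := by
  obtain ⟨l, hl, h⟩ := γ.exists_log hz
  obtain ⟨δ, hδ, hball⟩ := Metric.isOpen_iff.1 γ.isClosed_range.isOpen_compl z hz
  have hdist : ∀ t, δ ≤ ‖γ t - z‖ := fun t => by
    by_contra! hlt
    exact hball (by rwa [Metric.mem_ball, dist_eq_norm]) ⟨t, rfl⟩
  have hne : ∀ t, γ t - z ≠ 0 := fun t h0 => by
    have := hdist t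
    rw [h0, norm_zero] at this
    linarith
  -- `γ t - y` is `γ t - z` times this factor, whose distance from `1` is less than `1`; so its
  -- principal logarithm corrects `l`.
  have hslit : ∀ y ∈ Metric.ball z δ, ∀ t, 1 - (y - z) / (γ t - z) ∈ Complex.slitPlane := by
    intro y hy t
    rw [sub_eq_add_neg]
    apply Complex.mem_slitPlane_of_norm_lt_one
    rw [norm_neg, norm_div, div_lt_one (lt_of_lt_of_le hδ (hdist t))]
    exact lt_of_lt_of_le (by rwa [Metric.mem_ball, dist_eq_norm] at hy) (hdist t)
  have key : ∀ y ∈ Metric.ball z δ, γ.logIncrement y = γ.logIncrement z +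
      Complex.log (1 - (y - z) / (q - z)) - Complex.log (1 - (y - z) / (p - z)) := by
    intro y hy
    rw [γ.logIncrement_eq (l := fun t => l t + Complex.log (1 - (y - z) / (γ t - z))),
      γ.logIncrement_eq hl h]
    · simp only [γ.source, γ.target]
      ring
    · refine hl.add (Continuous.clog ?_ (hslit y hy))
      exact continuous_const.sub (continuous_const.div (by fun_prop) hne)
    · intro t
      rw [Complex.exp_add, Complex.exp_log (Complex.slitPlane_ne_zero (hslit y hy t)), h]
      field_simp [hne t]
      ring
  have hz0 := hslit z (Metric.mem_ball_self hδ)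
  refine ContinuousAt.congr ?_
    (eventually_of_mem (Metric.ball_mem_nhds z hδ) fun y hy => (key y hy).symm)
  refine (continuousAt_const.add (ContinuousAt.clog (by fun_prop) ?_)).sub
    (ContinuousAt.clog (by fun_prop) ?_)
  · simp
  · simp

/-- Far away from a closed curve there is no winding. -/
theorem exists_logIncrement_eq (γ₁ γ₂ : Path p q) :
    ∃ R : ℝ, ∀ z, R < ‖z‖ → γ₁.logIncrement z = γ₂.logIncrement z := by
  have aux : ∀ γ : Path p q, ∃ R : ℝ, ∀ z, R < ‖z‖ → γ.logIncrement z =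
      Complex.log (1 - q / z) - Complex.log (1 - p / z) := by
    intro γ
    obtain ⟨R, hR⟩ := (isCompact_range γ.continuous).isBounded.exists_norm_le
    refine ⟨R, fun z hz => ?_⟩
    have hR0 : 0 ≤ R := (norm_nonneg _).trans (hR _ ⟨0, rfl⟩)
    have hz0 : z ≠ 0 := norm_pos_iff.1 (hR0.trans_lt hz)
    have hslit : ∀ t, 1 - γ t / z ∈ Complex.slitPlane := fun t => by
      rw [sub_eq_add_neg]
      apply Complex.mem_slitPlane_of_norm_lt_one
      rw [norm_neg, norm_div, div_lt_one (hR0.trans_lt hz)]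
      exact (hR _ ⟨t, rfl⟩).trans_lt hz
    -- For large `z`, factor `γ t - z = (-z)(1 - γ t / z)`; the increment then depends on the ends
    -- alone.
    rw [γ.logIncrement_eq (l := fun t => Complex.log (-z) + Complex.log (1 - γ t / z))]
    · simp only [γ.source, γ.target]
      ring
    · exact continuous_const.add (Continuous.clog (by fun_prop) hslit)
    · intro t
      rw [Complex.exp_add, Complex.exp_log (Complex.slitPlane_ne_zero (hslit t)),
        Complex.exp_log (neg_ne_zero.2 hz0)]
      field_simp
      ring
  obtain ⟨R₁, h₁⟩ := aux γ₁
  obtain ⟨R₂, h₂⟩ := aux γ₂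
  refine ⟨max R₁ R₂, fun z hz => ?_⟩
  rw [h₁ z ((le_max_left _ _).trans_lt hz), h₂ z ((le_max_right _ _).trans_lt hz)]

/-- Winding is constant on connected sets that avoid the curve. -/
theorem logIncrement_sub_eq_of_isPreconnected (γ₁ γ₂ : Path p q) {S : Set ℂ}
    (hS : IsPreconnected S) (h₁ : Disjoint S (range γ₁)) (h₂ : Disjoint S (range γ₂))
    {x y : ℂ} (hx : x ∈ S) (hy : y ∈ S) :
    γ₁.logIncrement x - γ₂.logIncrement x = γ₁.logIncrement y - γ₂.logIncrement y := by
  rw [disjoint_left] at h₁ h₂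
  refine hS.sub_eq_sub_of_exp_eq
    (fun z hz => (γ₁.continuousAt_logIncrement (h₁ hz)).continuousWithinAt)
    (fun z hz => (γ₂.continuousAt_logIncrement (h₂ hz)).continuousWithinAt)
    (fun z hz => ?_) hx hy
  rw [γ₁.exp_logIncrement (h₁ hz), γ₂.exp_logIncrement (h₂ hz)]

/-- A closed curve made of two arcs that meet only in their ends winds around some point. -/
theorem exists_logIncrement_ne (γ₁ γ₂ : Path p q) (hpq : p ≠ q)
    (h : range γ₁ ∩ range γ₂ ⊆ {p, q}) :
    ∃ z, z ∉ range γ₁ ∪ range γ₂ ∧ γ₁.logIncrement z ≠ γ₂.logIncrement z := by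
  classical
  by_contra! hall
  -- Each increment is continuous off its own arc. If they agree off both arcs, they glue to a
  -- function continuous except at `p` and `q`.
  let L : ℂ → ℂ := fun z => if z ∈ range γ₁ then γ₂.logIncrement z else γ₁.logIncrement z
  have hL₁ : ∀ z ∉ range γ₁, L z = γ₁.logIncrement z := fun z hz => if_neg hz
  have hL₂ : ∀ z ∉ range γ₂, L z = γ₂.logIncrement z := fun z hz => by
    by_cases hz1 : z ∈ range γ₁
    · exact if_pos hz1
    · rw [hL₁ z hz1, hall z (by simp only [mem_union]; tauto)]
  have hcont : ∀ z, z ≠ p → z ≠ q →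
      ContinuousAt L z ∧ Complex.exp (L z) = (q - z) / (p - z) := by
    intro z hp hq
    by_cases hz1 : z ∈ range γ₁
    · have hz2 : z ∉ range γ₂ := fun hz2 => by
        rcases h ⟨hz1, hz2⟩ with h | h
        exacts [hp h, hq h]
      refine ⟨(γ₂.continuousAt_logIncrement hz2).congr ?_, ?_⟩
      · filter_upwards [γ₂.isClosed_range.isOpen_compl.mem_nhds hz2] with y hy
        exact (hL₂ y hy).symm
      · rw [hL₂ z hz2, γ₂.exp_logIncrement hz2]
    · refine ⟨(γ₁.continuousAt_logIncrement hz1).congr ?_, ?_⟩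
      · filter_upwards [γ₁.isClosed_range.isOpen_compl.mem_nhds hz1] with y hy
        exact (hL₁ y hy).symm
      · rw [hL₁ z hz1, γ₁.exp_logIncrement hz1]
  have hd : 0 < ‖q - p‖ := norm_pos_iff.2 (sub_ne_zero.2 hpq.symm)
  have hr : 0 < ‖q - p‖ / 2 := by positivity
  have hs : ∀ z ∈ Metric.sphere p (‖q - p‖ / 2), ‖z - p‖ = ‖q - p‖ / 2 := fun z hz => by
    rwa [← dist_eq_norm]
  have hzp : ∀ z ∈ Metric.sphere p (‖q - p‖ / 2), z ≠ p := fun z hz h0 => by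
    have := hs z hz
    rw [h0, sub_self, norm_zero] at this
    linarith
  have hzq : ∀ z ∈ Metric.sphere p (‖q - p‖ / 2), z ≠ q := fun z hz h0 => by
    have := hs z hz
    rw [h0] at this
    linarith
  have hslit : ∀ z ∈ Metric.sphere p (‖q - p‖ / 2),
      1 - (z - p) / (q - p) ∈ Complex.slitPlane := fun z hz => by
    rw [sub_eq_add_neg]
    apply Complex.mem_slitPlane_of_norm_lt_one
    rw [norm_neg, norm_div, hs z hz, div_lt_one hd]
    linarith
  have hqp : q - p ≠ 0 := sub_ne_zero.2 hpq.symm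
  -- The circle leaves `q` outside, so `z - q` has a logarithm on it; subtracting `L` would yield
  -- one of `z - p`.
  refine not_exists_exp_eq_sub_on_sphere p hr
    (fun z => Complex.log (-(q - p)) + Complex.log (1 - (z - p) / (q - p)) - L z) ?_ ?_
  · intro z hz
    refine ContinuousAt.continuousWithinAt (ContinuousAt.sub (continuousAt_const.add
      (ContinuousAt.clog ?_ (hslit z hz))) (hcont z (hzp z hz) (hzq z hz)).1)
    fun_prop
  · intro z hz
    rw [Complex.exp_sub, Complex.exp_add, Complex.exp_log (neg_ne_zero.2 hqp),
      Complex.exp_log (Complex.slitPlane_ne_zero (hslit z hz)),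
      (hcont z (hzp z hz) (hzq z hz)).2]
    have h1 : p - z ≠ 0 := sub_ne_zero.2 (hzp z hz).symm
    have h2 : q - z ≠ 0 := sub_ne_zero.2 (hzq z hz).symm
    field_simp
    ring

end Path

end

section

open Set Topology unitInterval Filter Bornology

/-! ### Components of complements of closed sets in the plane -/

/-- A connected set stays connected when a point of its closure is added. -/
theorem closure_connectedComponentIn_inter_subset {X : Type*} [TopologicalSpace X] (F : Set X)
    (x : X) : closure (connectedComponentIn F x) ∩ F ⊆ connectedComponentIn F x := by
  rintro y ⟨hy, hyF⟩
  by_cases hx : x ∈ F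
  · exact (isPreconnected_connectedComponentIn.subset_closure (subset_insert y _)
      (insert_subset hy subset_closure)).subset_connectedComponentIn
      (mem_insert_of_mem _ (mem_connectedComponentIn hx))
      (insert_subset hyF (connectedComponentIn_subset _ _)) (mem_insert _ _)
  · simp [connectedComponentIn_eq_empty hx] at hy

theorem Complex.isPreconnected_compl_closedBall (R : ℝ) :
    IsPreconnected (Metric.closedBall (0 : ℂ) R)ᶜ := by
  have : (Metric.closedBall (0 : ℂ) R)ᶜ =
      (fun x : ℝ × ℝ => (x.1 : ℂ) * Complex.exp (x.2 * Complex.I)) '' Ioi R ×ˢ univ := by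
    ext z
    simp only [mem_compl_iff, Metric.mem_closedBall, dist_zero_right, not_le, mem_image, mem_prod,
      mem_Ioi, mem_univ, and_true, Prod.exists]
    constructor
    · exact fun hz => ⟨‖z‖, z.arg, hz, Complex.norm_mul_exp_arg_mul_I z⟩
    · rintro ⟨r, θ, hr, rfl⟩
      rw [norm_mul, Complex.norm_exp_ofReal_mul_I, mul_one, Complex.norm_real]
      exact hr.trans_le (le_abs_self r)
  rw [this]
  exact (isPreconnected_Ioi.prod isPreconnected_univ).image _ (by fun_prop)

/-- The union of the unbounded components of the complement of a plane set. -/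
def outerRegion (C : Set ℂ) : Set ℂ := {x | ¬ IsBounded (connectedComponentIn Cᶜ x)}

theorem notMem_of_mem_outerRegion {C : Set ℂ} {x : ℂ} (hx : x ∈ outerRegion C) : x ∉ C :=
  fun hxC => hx (by simp [connectedComponentIn_eq_empty (F := Cᶜ) (not_not.2 hxC)])

theorem IsPreconnected.subset_outerRegion {C S : Set ℂ} (hS : IsPreconnected S)
    (hSC : Disjoint S C) {x : ℂ} (hxS : x ∈ S) (hx : x ∈ outerRegion C) : S ⊆ outerRegion C := by
  intro y hy hb
  apply hx
  rwa [connectedComponentIn_eq (hS.subset_connectedComponentIn hxS hSC.subset_compl_right hy)]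

theorem IsPreconnected.subset_outerRegion_of_not_isBounded {C S : Set ℂ} (hS : IsPreconnected S)
    (hSC : Disjoint S C) (hb : ¬ IsBounded S) : S ⊆ outerRegion C :=
  fun _ hy h => hb (h.subset (hS.subset_connectedComponentIn hy hSC.subset_compl_right))

/-- The outer region is closed in the complement. -/
theorem mem_outerRegion_of_mem_closure {C S : Set ℂ} (hC : IsClosed C) {x : ℂ} (hx : x ∉ C)
    (hxS : x ∈ closure S) (hS : S ⊆ outerRegion C) : x ∈ outerRegion C := by
  obtain ⟨δ, hδ, hball⟩ := Metric.isOpen_iff.1 hC.isOpen_compl x hx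
  obtain ⟨y, hyS, hy⟩ := Metric.mem_closure_iff.1 hxS δ hδ
  exact Metric.isPreconnected_ball.subset_outerRegion (disjoint_left.2 hball)
    (x := y) (by rwa [Metric.mem_ball, dist_comm]) (hS hyS) (Metric.mem_ball_self hδ)

/-- The outer region is open. -/
theorem mem_outerRegion_of_closure_inter {C S : Set ℂ} (hC : IsClosed C) (hS : IsPreconnected S)
    (hSC : Disjoint S C) {x : ℂ} (hx : x ∈ outerRegion C) (hxS : x ∈ closure S) :
    S ⊆ outerRegion C := by
  obtain ⟨δ, hδ, hball⟩ :=
    Metric.isOpen_iff.1 hC.isOpen_compl x (notMem_of_mem_outerRegion hx)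
  obtain ⟨y, hyS, hy⟩ := Metric.mem_closure_iff.1 hxS δ hδ
  refine hS.subset_outerRegion hSC hyS (Metric.isPreconnected_ball.subset_outerRegion
    (disjoint_left.2 hball) (Metric.mem_ball_self hδ) hx ?_)
  rwa [Metric.mem_ball, dist_comm]

/-- Winding is constant on the component of `z`, which reaches far out, where there is none. Unequal
increments thus certify that a point is inside. -/
theorem Path.logIncrement_eq_of_mem_outerRegion {p q : ℂ} (γ₁ γ₂ : Path p q) {z : ℂ}
    (hz : z ∈ outerRegion (range γ₁ ∪ range γ₂)) :
    γ₁.logIncrement z = γ₂.logIncrement z := by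
  obtain ⟨R, hR⟩ := γ₁.exists_logIncrement_eq γ₂
  have hsub := connectedComponentIn_subset (range γ₁ ∪ range γ₂)ᶜ z
  obtain ⟨y, hy, hyR⟩ :
      ∃ y ∈ connectedComponentIn (range γ₁ ∪ range γ₂)ᶜ z, R < ‖y‖ := by
    by_contra! h
    exact hz (isBounded_iff_forall_norm_le.2 ⟨R, h⟩)
  have := γ₁.logIncrement_sub_eq_of_isPreconnected γ₂ isPreconnected_connectedComponentIn
    (disjoint_left.2 fun x hx h => hsub hx (Or.inl h))
    (disjoint_left.2 fun x hx h => hsub hx (Or.inr h))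
    (mem_connectedComponentIn (notMem_of_mem_outerRegion hz)) hy
  rw [hR y hyR, sub_self] at this
  exact sub_eq_zero.1 this

/-! ### Arcs -/

namespace IsArcBetween

variable {A B : Set ℂ} {x y z : ℂ}

theorem isCompact (hA : IsArcBetween A x y) : IsCompact A := by
  obtain ⟨γ, -, rfl⟩ := hA
  exact isCompact_range γ.continuous

theorem isClosed (hA : IsArcBetween A x y) : IsClosed A := hA.isCompact.isClosed

theorem left_mem (hA : IsArcBetween A x y) : x ∈ A := by
  obtain ⟨γ, -, rfl⟩ := hA
  exact γ.source_mem_range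

theorem right_mem (hA : IsArcBetween A x y) : y ∈ A := by
  obtain ⟨γ, -, rfl⟩ := hA
  exact γ.target_mem_range

theorem ne (hA : IsArcBetween A x y) : x ≠ y := by
  obtain ⟨γ, hγ, rfl⟩ := hA
  intro h
  exact zero_ne_one (hγ (γ.source.trans (h.trans γ.target.symm)))

theorem symm (hA : IsArcBetween A x y) : IsArcBetween A y x := by
  obtain ⟨γ, hγ, rfl⟩ := hA
  exact ⟨γ.symm, hγ.comp unitInterval.symm_bijective.injective, γ.symm_range⟩

theorem trans (hA : IsArcBetween A x y) (hB : IsArcBetween B y z) (h : A ∩ B ⊆ {y}) :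
    IsArcBetween (A ∪ B) x z := by
  obtain ⟨γ, hγ, rfl⟩ := hA
  obtain ⟨δ, hδ, rfl⟩ := hB
  refine ⟨γ.trans δ, ?_, γ.trans_range δ⟩
  have cross : ∀ s t : I, γ s = δ t → t = 0 := fun s t hst => by
    have : δ t = y := h ⟨⟨s, hst⟩, ⟨t, rfl⟩⟩
    exact hδ (this.trans δ.source.symm)
  intro s t hst
  simp only [Path.trans_apply] at hst
  split_ifs at hst with h1 h2 h2
  · have := congrArg Subtype.val (hγ hst)
    simp only at this
    exact Subtype.ext (by linarith)
  · have := congrArg Subtype.val (cross _ _ hst)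
    simp only [Icc.coe_zero] at this
    exact absurd (show (t : ℝ) ≤ 1 / 2 by linarith) h2
  · have := congrArg Subtype.val (cross _ _ hst.symm)
    simp only [Icc.coe_zero] at this
    exact absurd (show (s : ℝ) ≤ 1 / 2 by linarith) h1
  · have := congrArg Subtype.val (hδ hst)
    simp only at this
    exact Subtype.ext (by linarith)

theorem image_Icc {γ : Path x y} (hγ : Function.Injective γ) {s t : I} (hst : s < t) :
    IsArcBetween (γ '' Icc s t) (γ s) (γ t) := by
  refine ⟨γ.subpath s t, hγ.comp fun a b hab => ?_, γ.range_subpath_of_le s t hst.le⟩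
  have h := congrArg Subtype.val hab
  simp only [Icc.coe_convexComb] at h
  have h0 : (0 : ℝ) < t - s := sub_pos.2 hst
  refine Subtype.ext (mul_left_cancel₀ h0.ne' ?_)
  linarith

theorem isPreconnected_diff (hA : IsArcBetween A x y) : IsPreconnected (A \ {x, y}) := by
  obtain ⟨γ, hγ, rfl⟩ := hA
  have : range γ \ {x, y} = γ '' Ioo 0 1 := by
    have h01 : Ioo (0 : I) 1 = univ \ {0, 1} := by
      ext t
      simp [unitInterval.pos_iff_ne_zero, unitInterval.lt_one_iff_ne_one]
    rw [h01, image_sdiff hγ, image_univ, image_pair, γ.source, γ.target]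
  rw [this]
  exact isPreconnected_Ioo.image _ γ.continuous.continuousOn

/-! ### Separation of the plane by arcs, closed curves and theta curves -/

/-- No component of the complement of an arc is bounded. -/
theorem compl_subset_outerRegion (hA : IsArcBetween A x y) : Aᶜ ⊆ outerRegion A := by
  classical
  have hcl := hA.isClosed
  obtain ⟨γ, hγ, rfl⟩ := hA
  intro a ha hb
  set U := connectedComponentIn (range γ)ᶜ a with hU
  have hUo : IsOpen U := hcl.isOpen_compl.connectedComponentIn
  have haU : a ∈ U := mem_connectedComponentIn ha
  have hUA : U ⊆ (range γ)ᶜ := connectedComponentIn_subset _ _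
  -- By Tietze the inverse of `γ` extends to the plane, so `γ ∘ g` retracts the plane onto the arc.
  obtain ⟨g, hg⟩ := ContinuousMap.exists_extension (γ.continuous.isClosedEmbedding hγ)
    (ContinuousMap.id I)
  have hg' : ∀ t, g (γ t) = t := fun t => congrArg (fun f : C(I, I) => f t) hg
  -- Retracting only the bounded component `U` is continuous, since the frontier of `U` lies on the
  -- arc. The map avoids `0`, so it has a logarithm on the plane; but on a large circle it is `z -
  -- a`.
  have hcont : Continuous fun z => if z ∈ U then γ (g z) - a else z - a := by
    refine Continuous.if (fun z hz => ?_) (by fun_prop) (by fun_prop)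
    have hzU : z ∉ U := fun h => (hUo.frontier_eq ▸ hz : z ∈ closure U \ U).2 h
    have hzA : z ∈ range γ := by
      by_contra hzA
      exact hzU (closure_connectedComponentIn_inter_subset _ _
        ⟨frontier_subset_closure hz, hzA⟩)
    obtain ⟨t, rfl⟩ := hzA
    rw [hg']
  obtain ⟨L, hL, hexp⟩ := hcont.exists_exp_eq fun z => by
    split_ifs with h
    · exact sub_ne_zero.2 fun h0 => ha ⟨_, h0⟩
    · exact sub_ne_zero.2 fun h0 => h (h0 ▸ haU)
  obtain ⟨r, hr, hUr⟩ := hb.subset_ball_lt 0 a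
  refine not_exists_exp_eq_sub_on_sphere a hr L hL.continuousOn fun z hz => ?_
  rw [hexp, if_neg]
  intro hzU
  exact (Metric.mem_ball.1 (hUr hzU)).ne hz

/-- An arc does not separate the plane. -/
theorem isPreconnected_compl (hA : IsArcBetween A x y) : IsPreconnected Aᶜ := by
  obtain ⟨R, hR⟩ := hA.isCompact.isBounded.subset_closedBall 0
  have hB := Complex.isPreconnected_compl_closedBall R
  have hBA : (Metric.closedBall (0 : ℂ) R)ᶜ ⊆ Aᶜ := compl_subset_compl.2 hR
  -- Every component is unbounded, so it meets the connected exterior of a disc that contains the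
  -- arc.
  have hmeet : ∀ a ∈ Aᶜ, (connectedComponentIn Aᶜ a ∩ (Metric.closedBall 0 R)ᶜ).Nonempty := by
    intro a ha
    by_contra h
    rw [not_nonempty_iff_eq_empty, ← disjoint_iff_inter_eq_empty, disjoint_compl_right_iff] at h
    exact hA.compl_subset_outerRegion ha (Metric.isBounded_closedBall.subset h)
  rcases eq_empty_or_nonempty Aᶜ with he | ⟨a₀, ha₀⟩
  · rw [he]
    exact isPreconnected_empty
  obtain ⟨b, -, hb⟩ := hmeet a₀ ha₀
  refine isPreconnected_of_forall b fun a ha => ?_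
  obtain ⟨c, hc, hcB⟩ := hmeet a ha
  exact ⟨connectedComponentIn Aᶜ a ∪ (Metric.closedBall 0 R)ᶜ,
    union_subset (connectedComponentIn_subset _ _) hBA, Or.inr hb,
    Or.inl (mem_connectedComponentIn ha),
    IsPreconnected.union c hc hcB isPreconnected_connectedComponentIn hB⟩

/-- If two arcs with common ends form a simple closed curve, every component of its complement
accumulates at the first arc. -/
theorem subset_closure_connectedComponentIn (hA : IsArcBetween A x y) (hB : IsArcBetween B x y)
    (hAB : A ∩ B ⊆ {x, y}) {a : ℂ} (ha : a ∉ A ∪ B) :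
    A ⊆ closure (connectedComponentIn (A ∪ B)ᶜ a) := by
  have hO : IsOpen (A ∪ B)ᶜ := (hA.isClosed.union hB.isClosed).isOpen_compl
  set U := connectedComponentIn (A ∪ B)ᶜ a with hU
  have hUo : IsOpen U := hO.connectedComponentIn
  have haU : a ∈ U := mem_connectedComponentIn ha
  have hUO : U ⊆ (A ∪ B)ᶜ := connectedComponentIn_subset _ _
  obtain ⟨γ, hγ, rfl⟩ := hA
  have hinter : ∀ t, γ t ∈ B → t = 0 ∨ t = 1 := fun t ht => by
    rcases hAB ⟨⟨t, rfl⟩, ht⟩ with h | h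
    exacts [.inl (hγ (h.trans γ.source.symm)), .inr (hγ (h.trans γ.target.symm))]
  have main : γ '' Ioo 0 1 ⊆ closure U := by
    rintro - ⟨τ, hτ, rfl⟩
    by_contra hτU
    have hJ : γ ⁻¹' (closure U)ᶜ ∈ 𝓝 τ :=
      (isClosed_closure.isOpen_compl.preimage γ.continuous).mem_nhds hτU
    obtain ⟨l, u, ⟨hlτ, hτu⟩, hlu⟩ := (mem_nhds_iff_exists_Ioo_subset' ⟨0, hτ.1⟩ ⟨1, hτ.2⟩).1 hJ
    obtain ⟨s, hls, hsτ⟩ := exists_between hlτ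
    obtain ⟨t, hτt, htu⟩ := exists_between hτu
    have hs0 : 0 < s := unitInterval.nonneg'.trans_lt hls
    have ht1 : t < 1 := htu.trans_le unitInterval.le_one'
    have h1 : IsArcBetween (γ '' Icc 0 s) x (γ s) := by
      simpa using image_Icc hγ hs0
    have h2 : IsArcBetween (γ '' Icc t 1) (γ t) y := by
      simpa using image_Icc hγ ht1
    have h3 : IsArcBetween (γ '' Icc 0 s ∪ B) (γ s) y := by
      refine h1.symm.trans hB ?_
      rintro - ⟨⟨r, hr, rfl⟩, hrB⟩
      rcases hinter r hrB with rfl | rfl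
      · simp
      · exact absurd (hsτ.trans hτ.2) hr.2.not_gt
    have h4 : IsArcBetween (γ '' Icc 0 s ∪ B ∪ γ '' Icc t 1) (γ s) (γ t) := by
      refine h3.trans h2.symm ?_
      rintro - ⟨hr', ⟨r, hr, rfl⟩⟩
      rcases hr' with ⟨r', hr', hrr⟩ | hrB
      · rw [← hγ hrr] at hr
        exact absurd (hr'.2.trans_lt (hsτ.trans hτt)) hr.1.not_gt
      · rcases hinter r hrB with rfl | rfl
        · exact absurd (hτ.1.trans hτt) hr.1.not_gt
        · simp
    set D := γ '' Icc 0 s ∪ B ∪ γ '' Icc t 1 with hD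
    have hDsub : D ⊆ range γ ∪ B := by
      rintro z ((⟨r, -, rfl⟩ | hr) | ⟨r, -, rfl⟩)
      exacts [.inl ⟨r, rfl⟩, .inr hr, .inl ⟨r, rfl⟩]
    have hτD : γ τ ∉ D := by
      rintro ((⟨r, hr, hrτ⟩ | hr) | ⟨r, hr, hrτ⟩)
      · exact absurd (hγ hrτ ▸ hr.2) hsτ.not_ge
      · rcases hinter τ hr with rfl | rfl
        exacts [hτ.1.false, hτ.2.false]
      · exact absurd (hγ hrτ ▸ hr.1) hτt.not_ge
    -- `D` is the closed curve with a gap around `γ τ`, hence an arc with connected complement. In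
    -- that complement `U` is open and closed, because its closure avoids the gap.
    have hsub : Dᶜ ⊆ U := by
      refine h4.isPreconnected_compl.subset_of_closure_inter_subset hUo
        ⟨a, fun h => ha (hDsub h), haU⟩ ?_
      rintro z ⟨hzU, hzD⟩
      refine closure_connectedComponentIn_inter_subset _ _ ⟨hzU, ?_⟩
      rintro (⟨r, rfl⟩ | hzB)
      · refine hlu ⟨?_, ?_⟩ hzU
        · refine hls.trans (not_le.1 fun h => hzD (.inl (.inl ⟨r, ⟨unitInterval.nonneg', h⟩, rfl⟩)))
        · refine lt_trans (not_le.1 fun h => hzD (.inr ⟨r, ⟨h, unitInterval.le_one'⟩, rfl⟩)) htu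
      · exact hzD (.inl (.inr hzB))
    exact hUO (hsub hτD) (.inl ⟨τ, rfl⟩)
  calc range γ = γ '' closure (Ioo 0 1) := by
        rw [closure_Ioo zero_ne_one, ← image_univ]
        congr 1
        exact (Icc_bot_top).symm
    _ ⊆ closure (γ '' Ioo 0 1) := image_closure_subset_closure_image γ.continuous
    _ ⊆ closure U := closure_minimal main isClosed_closure

/-- The **theta lemma**: of three arcs with common ends that are otherwise disjoint, one runs
inside the closed curve formed by the other two. -/
theorem theta {A₁ A₂ A₃ : Set ℂ} (h₁ : IsArcBetween A₁ x y) (h₂ : IsArcBetween A₂ x y)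
    (h₃ : IsArcBetween A₃ x y) (h₁₂ : A₁ ∩ A₂ ⊆ {x, y}) (h₁₃ : A₁ ∩ A₃ ⊆ {x, y})
    (h₂₃ : A₂ ∩ A₃ ⊆ {x, y}) {x₁ x₂ x₃ : ℂ} (hx₁ : x₁ ∈ A₁) (hx₂ : x₂ ∈ A₂) (hx₃ : x₃ ∈ A₃)
    (ho₁ : x₁ ∈ outerRegion (A₂ ∪ A₃)) (ho₂ : x₂ ∈ outerRegion (A₁ ∪ A₃))
    (ho₃ : x₃ ∈ outerRegion (A₁ ∪ A₂)) : False := by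
  have hne := h₁.ne
  have hc₁ := h₁.isClosed
  have hc₂ := h₂.isClosed
  have hc₃ := h₃.isClosed
  obtain ⟨γ₁, hγ₁, e₁⟩ := id h₁
  obtain ⟨γ₂, hγ₂, e₂⟩ := id h₂
  obtain ⟨γ₃, hγ₃, e₃⟩ := id h₃
  have hx : x ∈ A₁ ∪ A₂ := .inl h₁.left_mem
  have hy : y ∈ A₁ ∪ A₂ := .inl h₁.right_mem
  obtain ⟨a, ha, hne⟩ := γ₁.exists_logIncrement_ne γ₂ hne (by rwa [e₁, e₂])
  rw [e₁, e₂] at ha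
  have haO : a ∉ outerRegion (A₁ ∪ A₂) := fun h =>
    hne (γ₁.logIncrement_eq_of_mem_outerRegion γ₂ (by rwa [e₁, e₂]))
  set U := connectedComponentIn (A₁ ∪ A₂)ᶜ a with hU
  have haU : a ∈ U := mem_connectedComponentIn ha
  have hU₁₂ : Disjoint U (A₁ ∪ A₂) := disjoint_left.2 (connectedComponentIn_subset _ _)
  have hUc : IsPreconnected U := isPreconnected_connectedComponentIn
  -- If `A₃` has one point outside the first two arcs, all of it but its ends lies there, so it
  -- misses `U`.
  have h₃O : A₃ \ {x, y} ⊆ outerRegion (A₁ ∪ A₂) := by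
    refine h₃.isPreconnected_diff.subset_outerRegion ?_ ⟨hx₃, ?_⟩ ho₃
    · rw [disjoint_left]
      rintro z ⟨hz₃, hz⟩ (hz₁ | hz₂)
      exacts [hz (h₁₃ ⟨hz₁, hz₃⟩), hz (h₂₃ ⟨hz₂, hz₃⟩)]
    · rintro (rfl | rfl)
      exacts [notMem_of_mem_outerRegion ho₃ hx, notMem_of_mem_outerRegion ho₃ hy]
  have hU₃ : Disjoint U A₃ := by
    refine disjoint_left.2 fun z hzU hz₃ => haO ?_
    refine hUc.subset_outerRegion hU₁₂ hzU (h₃O ⟨hz₃, ?_⟩) haU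
    rintro (rfl | rfl)
    exacts [disjoint_left.1 hU₁₂ hzU hx, disjoint_left.1 hU₁₂ hzU hy]
  rw [disjoint_union_right] at hU₁₂
  -- `U` avoids `A₁ ∪ A₃` and accumulates at `x₂`, which is outside that curve; so `U` is outside it
  -- as well.
  have ha₁ : a ∈ outerRegion (A₁ ∪ A₃) := by
    refine mem_outerRegion_of_closure_inter (hc₁.union hc₃) hUc
      (disjoint_union_right.2 ⟨hU₁₂.1, hU₃⟩) ho₂ ?_ haU
    rw [hU, union_comm]
    exact h₂.subset_closure_connectedComponentIn h₁ (by rwa [inter_comm])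
      (by rwa [union_comm]) hx₂
  have ha₂ : a ∈ outerRegion (A₂ ∪ A₃) :=
    mem_outerRegion_of_closure_inter (hc₂.union hc₃) hUc
      (disjoint_union_right.2 ⟨hU₁₂.2, hU₃⟩) ho₁
      (h₁.subset_closure_connectedComponentIn h₂ h₁₂ ha hx₁) haU
  -- At `a` the increment along `γ₃` equals both others, which differ by the choice of `a`.
  refine hne ((γ₁.logIncrement_eq_of_mem_outerRegion γ₃ (by rwa [e₁, e₃])).trans
    (γ₂.logIncrement_eq_of_mem_outerRegion γ₃ (by rwa [e₂, e₃])).symm)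

end IsArcBetween

end

/-! ### Paths and cycles in 2-connected graphs -/

namespace SimpleGraph

variable {V : Type*} {G : SimpleGraph V}

namespace Walk

variable {u v : V}

/-- Two walks with common ends are internally disjoint if they have only their ends in common. -/
def InternallyDisjoint (p q : G.Walk u v) : Prop :=
  ∀ w, w ∈ p.support → w ∈ q.support → w = u ∨ w = v

theorem InternallyDisjoint.symm {p q : G.Walk u v} (h : p.InternallyDisjoint q) :
    q.InternallyDisjoint p := fun w hq hp => h w hp hq

/-- A common edge would have to join `u` to `v`, and a path from `u` to `v` through that edge has
length one. -/
theorem InternallyDisjoint.disjoint_edges {p q : G.Walk u v} (h : p.InternallyDisjoint q)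
    (hp : p.IsPath) (hl : 1 < p.length) : ∀ e ∈ p.edges, e ∉ q.edges := by
  intro e hep heq
  induction e with | _ a b
  have hne := (p.adj_of_mem_edges hep).ne
  have ha := h a (p.fst_mem_support_of_mem_edges hep) (q.fst_mem_support_of_mem_edges heq)
  have hb := h b (p.snd_mem_support_of_mem_edges hep) (q.snd_mem_support_of_mem_edges heq)
  have huv : s(u, v) ∈ p.edges := by
    rcases ha with rfl | rfl <;> rcases hb with rfl | rfl
    exacts [absurd rfl hne, hep, Sym2.eq_swap ▸ hep, absurd rfl hne]
  exact hl.ne' (hp.length_eq_one_of_mem_edges huv)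

theorem IsPath.exists_internal {p : G.Walk u v} (hp : p.IsPath) (hl : 1 < p.length) :
    ∃ w ∈ p.support, w ≠ u ∧ w ≠ v :=
  ⟨p.getVert 1, p.getVert_mem_support 1,
    fun h => one_ne_zero ((hp.getVert_eq_start_iff hl.le).1 h),
    fun h => hl.ne ((hp.getVert_eq_end_iff hl.le).1 h)⟩

theorem InternallyDisjoint.isCycle {p q : G.Walk u v} (h : p.InternallyDisjoint q)
    (hp : p.IsPath) (hq : q.IsPath) (hl : 1 < p.length) : (p.append q.reverse).IsCycle := by
  refine hp.isCycle_append hq.reverse (fun w hwp hwq => ?_) (.inl hl)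
  have hu : w ≠ u := by
    rintro rfl
    have := hp.support_nodup
    rw [← cons_tail_support, List.nodup_cons] at this
    exact this.1 hwp
  have hv : w ≠ v := by
    rintro rfl
    have := hq.reverse.support_nodup
    rw [← cons_tail_support, List.nodup_cons] at this
    exact this.1 hwq
  have hwq' : w ∈ q.support := by simpa using List.mem_of_mem_tail hwq
  exact (h w (List.mem_of_mem_tail hwp) hwq').elim hu hv

/-- Two vertices of a cycle split it into two internally disjoint paths. -/
theorem IsCycle.exists_split [DecidableEq V] {x : V} {c : G.Walk x x} (hc : c.IsCycle) {a b : V}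
    (ha : a ∈ c.support) (hb : b ∈ c.support) (hab : a ≠ b) :
    ∃ p q : G.Walk a b, p.IsPath ∧ q.IsPath ∧ p.InternallyDisjoint q ∧
      p.length + q.length = c.length ∧ (∀ e, e ∈ c.edges ↔ e ∈ p.edges ∨ e ∈ q.edges) ∧
      ∀ w, w ∈ c.support ↔ w ∈ p.support ∨ w ∈ q.support := by
  have hb' : b ∈ (c.rotate a ha).support := (c.mem_support_rotate_iff a ha).2 hb
  have hc' : (c.rotate a ha).IsCycle := hc.rotate ha
  set d := c.rotate a ha with hd
  have hspec := d.take_spec hb'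
  have hdrop : (d.dropUntil b hb').IsPath := by
    rw [← hspec] at hc'
    exact hc'.isPath_of_append_right (not_nil_of_ne hab)
  refine ⟨d.takeUntil b hb', (d.dropUntil b hb').reverse, hc'.isPath_takeUntil hb',
    hdrop.reverse, ?_, ?_, ?_, ?_⟩
  · intro w hp hq
    rw [support_reverse, List.mem_reverse] at hq
    have hnd := hc'.support_nodup
    rw [← hspec, tail_support_append, List.nodup_append'] at hnd
    rcases (mem_support_iff _).1 hp with rfl | hp
    · exact .inl rfl
    rcases (mem_support_iff _).1 hq with rfl | hq
    · exact .inr rfl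
    · exact absurd hq (hnd.2.2 hp)
  · rw [length_reverse, ← length_append, hspec, hd, length_rotate]
  · intro e
    rw [edges_reverse, List.mem_reverse, ← List.mem_append, ← edges_append, hspec,
      (c.rotate_edges a ha).perm.mem_iff]
  · intro w
    rw [support_reverse, List.mem_reverse, ← mem_support_append_iff, hspec,
      mem_support_rotate_iff]

end Walk

theorem Connected.exists_walk_notMem {x : V} (h : (G.induce {x}ᶜ).Connected) {a b : V}
    (ha : a ≠ x) (hb : b ≠ x) : ∃ p : G.Walk a b, x ∉ p.support := by
  obtain ⟨p⟩ := h.preconnected ⟨a, ha⟩ ⟨b, hb⟩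
  let f : G.induce {x}ᶜ →g G := (Embedding.induce {x}ᶜ).toHom
  refine ⟨p.map f, fun hx => ?_⟩
  have hx' : x ∈ p.support.map f := p.support_map f ▸ hx
  obtain ⟨w, -, hw⟩ := List.mem_map.1 hx'
  exact w.2 hw

/-! ### Cycles and ears in 2-connected graphs -/

namespace IsTwoConnected

/-- Two neighbours of `v`, joined by a path that avoids `v`, close up to a cycle through `v`. -/
theorem exists_isCycle (h : G.IsTwoConnected) : ∃ (v : V) (c : G.Walk v v), c.IsCycle := by
  classical
  obtain ⟨hcard, -, hcut⟩ := h
  have : Finite V := (Nat.card_pos_iff.1 (by omega)).2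
  have := Fintype.ofFinite V
  rw [Nat.card_eq_fintype_card] at hcard
  obtain ⟨v, a, b, hva, hvb, hab⟩ := Fintype.two_lt_card_iff.1 hcard
  obtain ⟨p, hp⟩ := (hcut a).exists_walk_notMem hva hab.symm
  have hvy := p.adj_snd (p.not_nil_of_ne hvb)
  have hya : p.snd ≠ a := fun h => hp (h ▸ p.getVert_mem_support 1)
  -- Leaving `v` while avoiding the first neighbour yields a second one.
  obtain ⟨q, hq⟩ := (hcut p.snd).exists_walk_notMem hvy.ne hya.symm
  have hvx := q.adj_snd (q.not_nil_of_ne hva)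
  have hxy : q.snd ≠ p.snd := fun h => hq (h ▸ q.getVert_mem_support 1)
  obtain ⟨r, hr⟩ := (hcut v).exists_walk_notMem hvx.ne' hvy.ne'
  let s : G.Walk q.snd p.snd := .cons hvx.symm (.cons hvy .nil)
  have hs : s.IsPath := by
    simp [s, Walk.cons_isPath_iff, hvx.ne', hvy.ne, hxy]
  have hd : s.InternallyDisjoint r.bypass := by
    intro w hw hwr
    have hwv : w ≠ v := by
      rintro rfl
      exact hr (r.support_bypass_subset_support hwr)
    simpa [s, hwv] using hw
  exact ⟨_, _, hd.isCycle hs r.bypass_isPath (by simp [s])⟩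

/-- A cycle that misses a vertex has an ear with an inner vertex. -/
theorem exists_ear [DecidableEq V] (h : G.IsTwoConnected) {x : V} {c : G.Walk x x}
    (hc : c.IsCycle) {w : V} (hw : w ∉ c.support) :
    ∃ (a b : V) (p : G.Walk a b), a ∈ c.support ∧ b ∈ c.support ∧ a ≠ b ∧ p.IsPath ∧
      1 < p.length ∧ ∀ y, y ∈ c.support → y ∈ p.support → y = a ∨ y = b := by
  obtain ⟨-, hconn, hcut⟩ := h
  obtain ⟨p₀⟩ := hconn.preconnected x w
  obtain ⟨d, -, ha, hv⟩ := p₀.exists_boundary_dart {y | y ∈ c.support} c.start_mem_support hw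
  obtain ⟨⟨a, v⟩, hav⟩ := d
  simp only [Set.mem_ofPred_eq] at ha hv
  obtain ⟨z, hz, hza⟩ : ∃ z ∈ c.support, z ≠ a := by
    by_cases hxa : x = a
    · exact ⟨c.snd, c.getVert_mem_support 1, hxa ▸ (c.adj_snd hc.not_nil).ne'⟩
    · exact ⟨x, c.start_mem_support, hxa⟩
  obtain ⟨q, hq⟩ := (hcut a).exists_walk_notMem hav.ne' hza
  -- The ear leaves the cycle along `av`, avoids `a` from then on, and stops at its first vertex `b`
  -- on the cycle.
  obtain ⟨b, hb, hbq, hfirst⟩ := q.exists_mem_support_forall_mem_support_imp_eq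
    (c.support.toFinset.erase a) ⟨z, by simp [hz, hza]⟩
  rw [Finset.mem_erase, List.mem_toFinset] at hb
  have hsub : ∀ y ∈ (q.takeUntil b hbq).bypass.support, y ∈ (q.takeUntil b hbq).support :=
    fun y hy => Walk.support_bypass_subset_support _ hy
  have haq : a ∉ (q.takeUntil b hbq).bypass.support :=
    fun h => hq (q.support_takeUntil_subset_support hbq (hsub a h))
  refine ⟨a, b, .cons hav (q.takeUntil b hbq).bypass, ha, hb.2, hb.1.symm, ?_, ?_, ?_⟩
  · exact (Walk.cons_isPath_iff _ _).2 ⟨Walk.bypass_isPath _, haq⟩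
  · have hvb : v ≠ b := fun h => hv (h ▸ hb.2)
    have : (q.takeUntil b hbq).bypass.length ≠ 0 := fun h => hvb (Walk.eq_of_length_eq_zero h)
    rw [Walk.length_cons]
    omega
  · intro y hyc hy
    rw [Walk.support_cons, List.mem_cons] at hy
    rcases hy with rfl | hy
    · exact .inl rfl
    by_cases hya : y = a
    · exact .inl hya
    · exact .inr (hfirst y (by simp [hya, hyc]) (hsub y hy))

end IsTwoConnected

theorem exists_isCycle_forall_length_le [Finite V] (h : ∃ (v : V) (c : G.Walk v v), c.IsCycle) :
    ∃ (v : V) (c : G.Walk v v), c.IsCycle ∧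
      ∀ (w : V) (d : G.Walk w w), d.IsCycle → d.length ≤ c.length := by
  have := Fintype.ofFinite V
  let S : Set ℕ := {n | ∃ (v : V) (c : G.Walk v v), c.IsCycle ∧ c.length = n}
  have hS : S.Nonempty := by
    obtain ⟨v, c, hc⟩ := h
    exact ⟨_, v, c, hc, rfl⟩
  have hbdd : BddAbove S := by
    refine ⟨Fintype.card V, ?_⟩
    rintro - ⟨v, c, hc, rfl⟩
    have := hc.isPath_tail.length_lt
    have := c.length_tail_add_one hc.not_nil
    omega
  obtain ⟨v, c, hc, hlen⟩ := Nat.sSup_mem hS hbdd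
  exact ⟨v, c, hc, fun w d hd => hlen ▸ le_csSup hbdd ⟨w, d, hd, rfl⟩⟩

theorem Walk.IsCycle.isHamiltonianCycle_of_mem [DecidableEq V] {v : V} {c : G.Walk v v}
    (hc : c.IsCycle) (h : ∀ w, w ∈ c.support) : c.IsHamiltonianCycle := by
  refine ⟨hc, hc.isPath_tail.isHamiltonian_of_mem fun w => ?_⟩
  rw [c.support_tail_of_not_nil hc.not_nil]
  rcases (c.mem_support_iff).1 (h w) with rfl | hw
  exacts [c.end_mem_tail_support hc.not_nil, hw]

end SimpleGraph

section

open Set SimpleGraph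

/-! ### Drawings -/

theorem IsArcBetween.exists_ne {A : Set ℂ} {x y : ℂ} (hA : IsArcBetween A x y) :
    ∃ z ∈ A, z ≠ x ∧ z ≠ y := by
  obtain ⟨γ, hγ, rfl⟩ := hA
  obtain ⟨t, ht⟩ := exists_between (zero_lt_one' unitInterval)
  exact ⟨γ t, ⟨t, rfl⟩, fun h => ht.1.ne' (hγ (h.trans γ.source.symm)),
    fun h => ht.2.ne (hγ (h.trans γ.target.symm))⟩

namespace PlaneGraph

variable {V : Type*} (Γ : PlaneGraph V)

/-- The part of the drawing that is formed by a set of edges. -/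
def drawing (E : Set (Sym2 V)) : Set ℂ :=
  ⋃ e : Γ.graph.edgeSet, ⋃ _ : (e : Sym2 V) ∈ E, Γ.arc e

variable {Γ} {E E' : Set (Sym2 V)} {z : ℂ} {u v w : V}

theorem mem_drawing : z ∈ Γ.drawing E ↔
    ∃ e : Γ.graph.edgeSet, (e : Sym2 V) ∈ E ∧ z ∈ Γ.arc e := by
  simp [drawing]

theorem drawing_union : Γ.drawing (E ∪ E') = Γ.drawing E ∪ Γ.drawing E' := by
  ext z
  simp only [mem_drawing, mem_union, or_and_right, exists_or]

theorem drawing_singleton (h : Γ.graph.Adj u v) :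
    Γ.drawing {s(u, v)} = Γ.arc ⟨s(u, v), h⟩ := by
  ext z
  rw [mem_drawing]
  constructor
  · rintro ⟨⟨e, he⟩, rfl, hz⟩
    exact hz
  · exact fun hz => ⟨_, mem_singleton _, hz⟩

theorem drawing_subset_pointSet : Γ.drawing E ⊆ Γ.pointSet := by
  intro z hz
  obtain ⟨e, -, hz⟩ := mem_drawing.1 hz
  exact .inr (mem_iUnion.2 ⟨e, hz⟩)

theorem isClosed_arc (e : Γ.graph.edgeSet) : IsClosed (Γ.arc e) := by
  obtain ⟨e, he⟩ := e
  induction e with | _ a b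
  exact (Γ.isArcBetween a b he).isClosed

theorem isClosed_drawing [Finite V] : IsClosed (Γ.drawing E) :=
  isClosed_iUnion_of_finite fun e => isClosed_iUnion_of_finite fun _ => isClosed_arc e

theorem point_mem_arc_iff (e : Γ.graph.edgeSet) : Γ.point w ∈ Γ.arc e ↔ w ∈ (e : Sym2 V) := by
  refine ⟨Γ.mem_of_point_mem_arc e w, fun h => ?_⟩
  obtain ⟨e, he⟩ := e
  induction e with | _ a b
  rcases Sym2.mem_iff.1 h with rfl | rfl
  exacts [(Γ.isArcBetween _ b he).left_mem, (Γ.isArcBetween a _ he).right_mem]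

/-- A trivial walk has a vertex but draws nothing, so it must be excluded. -/
theorem point_mem_drawing_edges {p : Γ.graph.Walk u v} (hp : ¬ p.Nil) :
    Γ.point w ∈ Γ.drawing {e | e ∈ p.edges} ↔ w ∈ p.support := by
  rw [mem_drawing, Walk.mem_support_iff_exists_mem_edges_of_not_nil hp]
  constructor
  · rintro ⟨e, he, hw⟩
    exact ⟨e, he, (point_mem_arc_iff e).1 hw⟩
  · rintro ⟨e, he, hw⟩
    exact ⟨⟨e, p.edges_subset_edgeSet he⟩, he, (point_mem_arc_iff _).2 hw⟩

theorem exists_point_of_mem_drawing_inter (hE : ∀ e ∈ E, e ∉ E') (hz : z ∈ Γ.drawing E)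
    (hz' : z ∈ Γ.drawing E') : ∃ w, Γ.point w = z := by
  obtain ⟨e, he, hze⟩ := mem_drawing.1 hz
  obtain ⟨f, hf, hzf⟩ := mem_drawing.1 hz'
  exact Γ.arc_inter_subset e f (fun h => hE e he (h ▸ hf)) ⟨hze, hzf⟩

theorem isArcBetween_drawing_edges {p : Γ.graph.Walk u v} (hp : p.IsPath) (huv : u ≠ v) :
    IsArcBetween (Γ.drawing {e | e ∈ p.edges}) (Γ.point u) (Γ.point v) := by
  induction p with
  | nil => exact absurd rfl huv
  | @cons u w v h p ih =>
    rw [Walk.cons_isPath_iff] at hp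
    have harc := Γ.isArcBetween u w h
    by_cases hwv : w = v
    · subst hwv
      obtain rfl := (Walk.isPath_iff_nil.1 hp.1).eq_nil
      have : {e | e ∈ (Walk.cons h (.nil : Γ.graph.Walk w w)).edges} = {s(u, w)} := by
        ext; simp
      rwa [this, drawing_singleton h]
    · have : {e | e ∈ (Walk.cons h p).edges} = {s(u, w)} ∪ {e | e ∈ p.edges} := by
        ext; simp
      rw [this, drawing_union, drawing_singleton h]
      refine harc.trans (ih hp.1 hwv) ?_
      rintro z ⟨hz₁, hz₂⟩
      have hnot : s(u, w) ∉ p.edges := fun h => hp.2 (p.fst_mem_support_of_mem_edges h)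
      obtain ⟨y, rfl⟩ := exists_point_of_mem_drawing_inter (E := {s(u, w)})
        (by rintro _ rfl; exact hnot) (by rwa [drawing_singleton h]) hz₂
      rcases Sym2.mem_iff.1 ((point_mem_arc_iff _).1 hz₁) with rfl | rfl
      · exact absurd ((point_mem_drawing_edges (Walk.not_nil_of_ne hwv)).1 hz₂) hp.2
      · rfl

theorem drawing_inter_drawing_subset {p q : Γ.graph.Walk u v} (hp : p.IsPath)
    (hl : 1 < p.length) (huv : u ≠ v) (h : p.InternallyDisjoint q) :
    Γ.drawing {e | e ∈ p.edges} ∩ Γ.drawing {e | e ∈ q.edges} ⊆ {Γ.point u, Γ.point v} := by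
  rintro z ⟨hz₁, hz₂⟩
  obtain ⟨y, rfl⟩ := exists_point_of_mem_drawing_inter (h.disjoint_edges hp hl) hz₁ hz₂
  rw [point_mem_drawing_edges (Walk.not_nil_of_ne huv)] at hz₁ hz₂
  rcases h y hz₁ hz₂ with rfl | rfl
  exacts [.inl rfl, .inr rfl]

/-! ### Outerplane drawings -/

theorem IsOuterFace.subset_outerRegion {F : Set ℂ} (hF : Γ.IsOuterFace F) :
    F ⊆ outerRegion (Γ.drawing E) := by
  obtain ⟨⟨x, -, rfl⟩, hb⟩ := hF
  exact isPreconnected_connectedComponentIn.subset_outerRegion_of_not_isBounded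
    (Set.disjoint_left.2 fun z hz h =>
      connectedComponentIn_subset _ _ hz (drawing_subset_pointSet h)) hb

/-- The outer face is connected, unbounded and off every partial drawing, so it lies outside; the
vertex is in its closure. -/
theorem IsOuterplane.point_mem_outerRegion [Finite V] (hΓ : Γ.IsOuterplane)
    (h : Γ.point w ∉ Γ.drawing E) : Γ.point w ∈ outerRegion (Γ.drawing E) := by
  obtain ⟨F, hF, hw⟩ := hΓ
  exact mem_outerRegion_of_mem_closure isClosed_drawing h (frontier_subset_closure (hw w))
    hF.subset_outerRegion

/-- In an outerplane graph, a path that joins two vertices of a cycle and is internally disjoint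
from it runs inside the cycle if it bypasses no single edge of it. -/
theorem IsOuterplane.disjoint_outerRegion [Finite V] (hΓ : Γ.IsOuterplane)
    {p₁ p₂ p₃ : Γ.graph.Walk u v} (h₁ : p₁.IsPath) (h₂ : p₂.IsPath) (h₃ : p₃.IsPath)
    (hl₁ : 1 < p₁.length) (hl₂ : 1 < p₂.length) (huv : u ≠ v)
    (h₁₂ : p₁.InternallyDisjoint p₂) (h₁₃ : p₁.InternallyDisjoint p₃)
    (h₂₃ : p₂.InternallyDisjoint p₃) :
    Disjoint (Γ.drawing {e | e ∈ p₃.edges})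
      (outerRegion (Γ.drawing ({e | e ∈ p₁.edges} ∪ {e | e ∈ p₂.edges}))) := by
  rw [Set.disjoint_left]
  intro x₃ hx₃ ho₃
  obtain ⟨w₁, hw₁, hwu₁, hwv₁⟩ := h₁.exists_internal hl₁
  obtain ⟨w₂, hw₂, hwu₂, hwv₂⟩ := h₂.exists_internal hl₂
  have hn : ∀ p : Γ.graph.Walk u v, ¬ p.Nil := fun p => Walk.not_nil_of_ne huv
  refine (isArcBetween_drawing_edges h₁ huv).theta (isArcBetween_drawing_edges h₂ huv)
    (isArcBetween_drawing_edges h₃ huv)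
    (drawing_inter_drawing_subset h₁ hl₁ huv h₁₂) (drawing_inter_drawing_subset h₁ hl₁ huv h₁₃)
    (drawing_inter_drawing_subset h₂ hl₂ huv h₂₃)
    ((point_mem_drawing_edges (hn p₁)).2 hw₁) ((point_mem_drawing_edges (hn p₂)).2 hw₂) hx₃
    ?_ ?_ (by rwa [← drawing_union])
  · rw [← drawing_union]
    refine hΓ.point_mem_outerRegion ?_
    rw [drawing_union, mem_union, point_mem_drawing_edges (hn p₂), point_mem_drawing_edges (hn p₃)]
    rintro (h | h)
    exacts [(h₁₂ w₁ hw₁ h).elim hwu₁ hwv₁, (h₁₃ w₁ hw₁ h).elim hwu₁ hwv₁]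
  · rw [← drawing_union]
    refine hΓ.point_mem_outerRegion ?_
    rw [drawing_union, mem_union, point_mem_drawing_edges (hn p₁), point_mem_drawing_edges (hn p₃)]
    rintro (h | h)
    exacts [(h₁₂ w₂ h hw₂).elim hwu₂ hwv₂, (h₂₃ w₂ hw₂ h).elim hwu₂ hwv₂]

/-- A longest cycle of a 2-connected outerplane graph is Hamiltonian. -/
theorem IsOuterplane.exists_isHamiltonianCycle [Finite V] [DecidableEq V] (hΓ : Γ.IsOuterplane)
    (h2 : Γ.graph.IsTwoConnected) :
    ∃ (v : V) (c : Γ.graph.Walk v v), c.IsHamiltonianCycle := by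
  obtain ⟨x, c, hc, hmax⟩ := exists_isCycle_forall_length_le h2.exists_isCycle
  refine ⟨x, c, hc.isHamiltonianCycle_of_mem ?_⟩
  by_contra! hw
  obtain ⟨w, hw⟩ := hw
  obtain ⟨a, b, p₃, ha, hb, hab, h₃, hl₃, hdisj⟩ := h2.exists_ear hc hw
  obtain ⟨p₁, p₂, h₁, h₂, h₁₂, hlen, -, hsupp⟩ := hc.exists_split ha hb hab
  have h₁₃ : p₁.InternallyDisjoint p₃ := fun y hy => hdisj y ((hsupp y).2 (.inl hy))
  have h₂₃ : p₂.InternallyDisjoint p₃ := fun y hy => hdisj y ((hsupp y).2 (.inr hy))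
  -- Since `p₁` and `p₂` make up `c`, maximality forces each to be at least as long as the ear, so
  -- each has an inner vertex. Then the ear runs inside `c`, while its inner vertex lies outside.
  have key : ∀ p : Γ.graph.Walk a b, p.IsPath → p.InternallyDisjoint p₃ →
      p.length + p₃.length ≤ c.length := fun p hp hd => by
    have := hmax _ _ (hd.symm.isCycle h₃ hp hl₃)
    rw [Walk.length_append, Walk.length_reverse] at this
    omega
  have k₁ := key p₁ h₁ h₁₃
  have k₂ := key p₂ h₂ h₂₃
  obtain ⟨w₃, hw₃, hwa, hwb⟩ := h₃.exists_internal hl₃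
  have hn : ∀ p : Γ.graph.Walk a b, ¬ p.Nil := fun p => Walk.not_nil_of_ne hab
  refine Set.disjoint_left.1 (hΓ.disjoint_outerRegion h₁ h₂ h₃ (by omega) (by omega) hab h₁₂ h₁₃ h₂₃)
    ((point_mem_drawing_edges (hn p₃)).2 hw₃) (hΓ.point_mem_outerRegion ?_)
  rw [drawing_union, mem_union, point_mem_drawing_edges (hn p₁), point_mem_drawing_edges (hn p₂)]
  rintro (h | h)
  exacts [(h₁₃ w₃ h hw₃).elim hwa hwb, (h₂₃ w₃ h hw₃).elim hwa hwb]

/-- A chord of a Hamiltonian cycle of an outerplane graph runs inside the cycle. -/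
theorem IsOuterplane.disjoint_arc_outerRegion [Finite V] [DecidableEq V] (hΓ : Γ.IsOuterplane)
    {x : V} {c : Γ.graph.Walk x x} (hc : c.IsHamiltonianCycle) (huv : Γ.graph.Adj u v)
    (hnot : s(u, v) ∉ c.edges) :
    Disjoint (Γ.arc ⟨s(u, v), huv⟩) (outerRegion (Γ.drawing {e | e ∈ c.edges})) := by
  obtain ⟨p₁, p₂, h₁, h₂, h₁₂, -, hedges, -⟩ :=
    hc.isCycle.exists_split (hc.mem_support u) (hc.mem_support v) huv.ne
  -- A path of length one from `u` to `v` would be the chord itself.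
  have hlen : ∀ p : Γ.graph.Walk u v, s(u, v) ∉ p.edges → 1 < p.length := fun p hp => by
    by_contra! hle
    have h1 : p.length = 1 := le_antisymm hle
      (Nat.one_le_iff_ne_zero.2 fun h => huv.ne (Walk.eq_of_length_eq_zero h))
    cases p with
    | nil => simp at h1
    | cons h q =>
      obtain rfl := Walk.eq_of_length_eq_zero (p := q) (by simpa using h1)
      simp at hp
  have hid : ∀ p : Γ.graph.Walk u v, p.InternallyDisjoint huv.toWalk := fun p w _ hw => by
    simpa using hw
  have hD : {e | e ∈ c.edges} = {e | e ∈ p₁.edges} ∪ {e | e ∈ p₂.edges} := by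
    ext e
    exact hedges e
  have h₃ : {e | e ∈ huv.toWalk.edges} = {s(u, v)} := by
    ext
    simp
  have := hΓ.disjoint_outerRegion h₁ h₂ (p₃ := huv.toWalk)
    (by simp [Walk.cons_isPath_iff, huv.ne])
    (hlen p₁ fun h => hnot ((hedges _).2 (.inl h)))
    (hlen p₂ fun h => hnot ((hedges _).2 (.inr h))) huv.ne h₁₂ (hid p₁) (hid p₂)
  rwa [h₃, drawing_singleton huv, ← hD] at this

/-- The components of the complement of a cycle accumulate at every point of the cycle. -/
theorem drawing_subset_closure_connectedComponentIn [DecidableEq V] {x : V}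
    {c : Γ.graph.Walk x x} (hc : c.IsCycle) (hz : z ∉ Γ.drawing {e | e ∈ c.edges}) :
    Γ.drawing {e | e ∈ c.edges} ⊆
      closure (connectedComponentIn (Γ.drawing {e | e ∈ c.edges})ᶜ z) := by
  have hne := (c.adj_snd hc.not_nil).ne
  obtain ⟨p₁, p₂, h₁, h₂, h₁₂, hlen, hedges, -⟩ :=
    hc.exists_split c.start_mem_support (c.getVert_mem_support 1) hne
  have hD : {e | e ∈ c.edges} = {e | e ∈ p₁.edges} ∪ {e | e ∈ p₂.edges} := by
    ext e
    exact hedges e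
  have hinter : Γ.drawing {e | e ∈ p₁.edges} ∩ Γ.drawing {e | e ∈ p₂.edges} ⊆
      {Γ.point x, Γ.point c.snd} := by
    -- A cycle has length at least three, so one of the two paths is longer than an edge.
    have := hc.three_le_length
    by_cases hl : 1 < p₁.length
    · exact drawing_inter_drawing_subset h₁ hl hne h₁₂
    · rw [inter_comm]
      exact drawing_inter_drawing_subset h₂ (by omega) hne h₁₂.symm
  have ha₁ := isArcBetween_drawing_edges h₁ hne
  have ha₂ := isArcBetween_drawing_edges h₂ hne
  rw [hD, drawing_union] at hz ⊢
  refine union_subset (ha₁.subset_closure_connectedComponentIn ha₂ hinter hz) ?_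
  rw [union_comm] at hz ⊢
  exact ha₂.subset_closure_connectedComponentIn ha₁ (by rwa [inter_comm]) hz

/-- All vertices lie on `c` and all other edges run inside it, so the component of the complement of
`c` around the outer face contains no more of the drawing and lies in that face. It accumulates at
all of `c`. -/
theorem IsOuterplane.drawing_subset_frontier [Finite V] [DecidableEq V] (hΓ : Γ.IsOuterplane)
    {x : V} {c : Γ.graph.Walk x x} (hc : c.IsHamiltonianCycle) {F : Set ℂ}
    (hF : Γ.IsOuterFace F) : Γ.drawing {e | e ∈ c.edges} ⊆ frontier F := by
  have hout := hF.subset_outerRegion (E := {e | e ∈ c.edges})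
  obtain ⟨⟨z, hz, rfl⟩, hb⟩ := hF
  set D := Γ.drawing {e | e ∈ c.edges} with hD
  have hzF : z ∈ connectedComponentIn Γ.pointSetᶜ z := mem_connectedComponentIn hz
  have hDX : D ⊆ Γ.pointSet := drawing_subset_pointSet
  have hzD : z ∉ D := fun h => hz (hDX h)
  have hUout : connectedComponentIn Dᶜ z ⊆ outerRegion D :=
    isPreconnected_connectedComponentIn.subset_outerRegion
      (Set.disjoint_left.2 (connectedComponentIn_subset _ _)) (mem_connectedComponentIn hzD) (hout hzF)
  have hUF : connectedComponentIn Dᶜ z ⊆ connectedComponentIn Γ.pointSetᶜ z := by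
    refine isPreconnected_connectedComponentIn.subset_connectedComponentIn
      (mem_connectedComponentIn hzD) fun y hy => ?_
    have hyD : y ∉ D := connectedComponentIn_subset _ _ hy
    rintro (⟨w, rfl⟩ | hyX)
    · exact hyD ((point_mem_drawing_edges hc.isCycle.not_nil).2 (hc.mem_support w))
    · obtain ⟨⟨e, he⟩, hye⟩ := mem_iUnion.1 hyX
      by_cases hec : e ∈ c.edges
      · exact hyD (mem_drawing.2 ⟨⟨e, he⟩, hec, hye⟩)
      · induction e with | _ a b
        exact Set.disjoint_left.1 (hΓ.disjoint_arc_outerRegion hc he hec) hye (hUout hy)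
  intro y hy
  refine ⟨closure_mono hUF (drawing_subset_closure_connectedComponentIn hc.isCycle hzD hy),
    fun h => ?_⟩
  exact connectedComponentIn_subset _ _ (interior_subset h) (hDX hy)

theorem IsOuterplane.toSubgraph_eq_boundary [Finite V] [DecidableEq V] (hΓ : Γ.IsOuterplane)
    {x : V} {c : Γ.graph.Walk x x} (hc : c.IsHamiltonianCycle) {F : Set ℂ}
    (hF : Γ.IsOuterFace F) : c.toSubgraph = Γ.boundary F := by
  have hfr := hΓ.drawing_subset_frontier hc hF
  refine Subgraph.ext ?_ ?_
  · ext w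
    rw [Walk.mem_verts_toSubgraph]
    exact iff_of_true (hc.mem_support w)
      (hfr ((point_mem_drawing_edges hc.isCycle.not_nil).2 (hc.mem_support w)))
  · ext a b
    rw [Walk.adj_toSubgraph_iff_mem_edges]
    constructor
    · exact fun hab => ⟨c.adj_of_mem_edges hab,
        fun z hz => hfr (mem_drawing.2 ⟨⟨s(a, b), c.adj_of_mem_edges hab⟩, hab, hz⟩)⟩
    · rintro ⟨hab, hsub⟩
      by_contra hnot
      -- An inner point of a chord on the boundary would be off `c` and in the closure of the outer
      -- face, hence outside `c`; but chords run inside.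
      obtain ⟨t, ht, hta, htb⟩ := (Γ.isArcBetween a b hab).exists_ne
      refine Set.disjoint_left.1 (hΓ.disjoint_arc_outerRegion hc hab hnot) ht
        (mem_outerRegion_of_mem_closure isClosed_drawing ?_ (frontier_subset_closure (hsub ht))
          hF.subset_outerRegion)
      intro htD
      obtain ⟨w, rfl⟩ := exists_point_of_mem_drawing_inter (E := {s(a, b)})
        (by rintro _ rfl; exact hnot) (by rwa [drawing_singleton hab]) htD
      rcases Sym2.mem_iff.1 ((point_mem_arc_iff _).1 ht) with rfl | rfl
      exacts [hta rfl, htb rfl]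

end PlaneGraph

end

theorem mainTheorem7 {V : Type*} [Finite V] [DecidableEq V] (Γ : PlaneGraph V)
    (h2 : Γ.graph.IsTwoConnected) (hout : Γ.IsOuterplane)
    (hbdd : ∃ F, Γ.IsBoundedFace F)
    (F₀ : Set Plane) (hF₀ : Γ.IsOuterFace F₀) :
    SimpleGraph.IsHamiltonianCircle (Γ.boundary F₀) ∧
      ∀ C : Γ.graph.Subgraph, SimpleGraph.IsHamiltonianCircle C → C = Γ.boundary F₀ := by
  obtain ⟨v, c, hc⟩ := hout.exists_isHamiltonianCycle h2
  refine ⟨⟨v, c, hc, hout.toSubgraph_eq_boundary hc hF₀⟩, ?_⟩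
  rintro - ⟨w, d, hd, rfl⟩
  exact hout.toSubgraph_eq_boundary hd hF₀
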